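/- For integers $n,k,\ell,m\ge 0$ let $A_4(n;k,\ell,m)$ denote the number of partitions $\lambda=(\lambda_1\ge\lambda_2\ge\cdots)$ of $n$ having exactly $k$, $\ell$ and $m$ parts congruent to $1$, $2$ and $3$ modulo $4$, respectively, with no part equal to $3$, and such that every two consecutive parts satisfy $\lambda_i-\lambda_{i+1}\ge 5$ whenever (i) $\lambda_i\equiv 3 \pmod 4$, or (ii) $\lambda_i\equiv 0,1\pmod 4$ and $\lambda_{i+1}\equiv 1,2\pmod 4$. Write $(x;q)_\infty=\prod_{i\ge 0}(1-xq^i)$. Then, as formal power series in $q,a,c,d$, $$\sum_{n,k,\ell,m\ge 0}A_4(n;k,\ell,m)\,q^n a^k c^\ell d^m=\frac{(-aq;q^8)_\infty(-dq^7;q^8)_\infty}{(q^4;q^4)_\infty(cq^2;q^8)_\infty}.$$ In other words, if $B_4(n;k,\ell,m)$ denotes the number of partitions of $n$ into even parts not congruent to $6$ modulo $8$ and distinct odd parts congruent to $\pm1$ modulo $8$, having exactly $k$, $\ell$ and $m$ parts congruent to $1$, $2$ and $7$ modulo $8$, respectively, then $A_4(n;k,\ell,m)=B_4(n;k,\ell,m)$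 for all $n,k,\ell,m\ge 0$. -/

import Mathlib

open scoped MvPowerSeries.WithPiTopology

/-- The infinite `q`-Pochhammer symbol `(x; q)_∞ = ∏_{i ≥ 0} (1 - x q^i)`. -/
noncomputable def qPochInf {R : Type*} [CommRing R] [TopologicalSpace R] (x q : R) : R :=
  ∏' i : ℕ, (1 - x * q ^ i)

/-- The number of parts of the partition `p` that are congruent to `r` modulo `M`. -/
def numPartsMod {n : ℕ} (p : n.Partition) (M r : ℕ) : ℕ :=
  p.parts.countP (fun x => x ≡ r [MOD M])

/-- The difference condition on consecutive parts `x = λ_i ≥ y = λ_{i+1}`: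
`x - y ≥ 5` if `x ≡ 3 (mod 4)`, or if `x ≡ 0, 1 (mod 4)` and `y ≡ 1, 2 (mod 4)`. -/
def GapCondition (x y : ℕ) : Prop :=
  (x % 4 = 3 ∨ ((x % 4 = 0 ∨ x % 4 = 1) ∧ (y % 4 = 1 ∨ y % 4 = 2))) → y + 5 ≤ x

instance (x y : ℕ) : Decidable (GapCondition x y) := by
  unfold GapCondition; infer_instance

/-- The number `A₄(n; k, ℓ, m)` of partitions `λ₁ ≥ λ₂ ≥ ⋯` of `n` with `k`, `ℓ`, `m` parts
congruent to `1`, `2`, `3` modulo `4`, with no part equal to `3`, whose consecutive parts all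
satisfy the difference condition. -/
def A4 (n k l m : ℕ) : ℕ :=
  (Finset.univ.filter (fun p : n.Partition =>
    numPartsMod p 4 1 = k ∧ numPartsMod p 4 2 = l ∧ numPartsMod p 4 3 = m ∧
    3 ∉ p.parts ∧ (p.parts.sort (· ≥ ·)).IsChain GapCondition)).card

/-- The number `B₄(n; k, ℓ, m)` of partitions of `n` into even parts not congruent to `6` modulo
`8` and distinct odd parts congruent to `±1` modulo `8`, with `k`, `ℓ`, `m` parts congruent to
`1`, `2`, `7` modulo `8`. -/
def B4 (n k l m : ℕ) : ℕ :=
  (Finset.univ.filter (fun p : n.Partition =>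
    numPartsMod p 8 1 = k ∧ numPartsMod p 8 2 = l ∧ numPartsMod p 8 7 = m ∧
    (∀ x ∈ p.parts, (Even x ∧ x % 8 ≠ 6) ∨
      (p.parts.count x = 1 ∧ (x % 8 = 1 ∨ x % 8 = 7))))).card

/-- The generating function `∑ A₄(n; k, ℓ, m) qⁿ aᵏ cˡ dᵐ`, as a formal power series in
`q = X 0`, `a = X 1`, `c = X 2`, `d = X 3`. -/
noncomputable def A4GenFun : MvPowerSeries (Fin 4) ℤ :=
  fun e => (A4 (e 0) (e 1) (e 2) (e 3) : ℤ)

/-!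
Read increasingly and preceded by a `0`, the partitions counted by `A4` become chains for a relation
invariant under adding `4` to every part. Splitting off the part after the leading one therefore
gives a linear recurrence for the generating functions `G_s(x)` of the chains of `s` parts
following `x`, and `(q⁴; q⁴)_s G_s(0)` turns out to be an Al-Salam–Chihara polynomial with base
`p = q⁸` and parameters `A = aq`, `C = cq²`, `E = dq⁷`. Such polynomials have a `q`-adic limit
`G(A, C, E)`, for which the contiguous relations become `G(A, C, E) = (1 + A) G(Ap, C, E)`, the same
for `E`, and `G(A, Cp, E) = (1 - C) G(A, C, E)`; iterating these gives
`G = (-A; p)_∞ (-E; p)_∞ / (C; p)_∞`. On the other hand `G` is `(q⁴; q⁴)_∞` times the generating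
function of the numbers `A4`, since leading zeros allow a chain of `s` parts to encode any partition
with at most `s` parts. The numbers `B4` are read off the resulting product.
-/

section QPochhammer

variable {R : Type*} [CommRing R]

/-- The finite `q`-Pochhammer symbol `(x; q)_n = ∏_{i < n} (1 - x q^i)`. -/
def qPoch (x q : R) (n : ℕ) : R :=
  ∏ i ∈ Finset.range n, (1 - x * q ^ i)

theorem qPoch_zero (x q : R) : qPoch x q 0 = 1 :=
  Finset.prod_range_zero _

theorem qPoch_succ (x q : R) (n : ℕ) : qPoch x q (n + 1) = qPoch x q n * (1 - x * q ^ n) :=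
  Finset.prod_range_succ _ _

theorem map_qPoch {S : Type*} [CommRing S] (f : R →+* S) (x q : R) (n : ℕ) :
    f (qPoch x q n) = qPoch (f x) (f q) n := by
  simp only [qPoch, map_prod, map_sub, map_one, map_mul, map_pow]

end QPochhammer

section PowerSeries

open MvPowerSeries Filter Topology

variable {σ R : Type*} [CommRing R] [TopologicalSpace R]

theorem multipliable_one_sub_mul_pow (x : MvPowerSeries σ R) {y : MvPowerSeries σ R}
    (hy : constantCoeff y = 0) : Multipliable fun i : ℕ => 1 - x * y ^ i := by
  simp only [sub_eq_add_neg]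
  refine WithPiTopology.multipliable_one_add_of_tendsto_order_atTop_nhds_top ?_
  rw [ENat.tendsto_nhds_top_iff_natCast_lt]
  intro n
  filter_upwards [eventually_gt_atTop n] with i hi
  rw [← neg_mul]
  exact (Nat.cast_lt.2 hi).trans_le ((le_order_pow_of_constantCoeff_eq_zero i hy).trans
    (le_add_self.trans le_order_mul))

theorem tendsto_qPoch (x : MvPowerSeries σ R) {y : MvPowerSeries σ R}
    (hy : constantCoeff y = 0) : Tendsto (qPoch x y) atTop (𝓝 (qPochInf x y)) :=
  (multipliable_one_sub_mul_pow x hy).hasProd.tendsto_prod_nat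

theorem constantCoeff_qPochInf [T2Space R] {x y : MvPowerSeries σ R} (hx : constantCoeff x = 0)
    (hy : constantCoeff y = 0) : constantCoeff (qPochInf x y) = 1 := by
  refine tendsto_nhds_unique ((WithPiTopology.continuous_constantCoeff R).continuousAt.tendsto.comp
    (tendsto_qPoch x hy)) (tendsto_const_nhds.congr fun n => ?_)
  simp [qPoch, hx]

theorem tendsto_of_eventually_coeff_eq {ι : Type*} {l : Filter ι} {f : ι → MvPowerSeries σ R}
    {g : MvPowerSeries σ R} (h : ∀ e, ∀ᶠ i in l, coeff e (f i) = coeff e g) :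
    Tendsto f l (𝓝 g) :=
  (WithPiTopology.tendsto_iff_coeff_tendsto ..).2 fun e =>
    tendsto_const_nhds.congr' ((h e).mono fun _ h => h.symm)

end PowerSeries

section AlSalamChihara

variable {R : Type*} [CommRing R]

/-- The Al-Salam–Chihara polynomials, homogenised so that no square roots occur: in terms of the
usual polynomials `Q_s(x; α, β | p)`, this is `C^(s/2) Q_s(x; α, β | p)` with
`2 x = C^(1/2) + C^(-1/2)`, `α = -A C^(-1/2)` and `β = -E C^(-1/2)`. -/
def alSalamChihara (A C E p : R) : ℕ → R
  | 0 => 1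
  | 1 => 1 + A + C + E
  | s + 2 => (1 + C + (A + E) * p ^ (s + 1)) * alSalamChihara A C E p (s + 1) +
      (1 - p ^ (s + 1)) * (A * E * p ^ s - C) * alSalamChihara A C E p s

variable (A C E p : R)

theorem alSalamChihara_swap (s : ℕ) : alSalamChihara A C E p s = alSalamChihara E C A p s := by
  induction s using Nat.twoStepInduction with
  | zero => rfl
  | one => simp only [alSalamChihara]; ring
  | more s ih₁ ih₂ => simp only [alSalamChihara, ih₁, ih₂]; ring

theorem map_alSalamChihara {S : Type*} [CommRing S] (f : R →+* S) (s : ℕ) :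
    f (alSalamChihara A C E p s) = alSalamChihara (f A) (f C) (f E) (f p) s := by
  induction s using Nat.twoStepInduction with
  | zero => simp [alSalamChihara]
  | one => simp [alSalamChihara]
  | more s ih₁ ih₂ => simp [alSalamChihara, ih₁, ih₂]

theorem alSalamChihara_zero_zero_zero (s : ℕ) : alSalamChihara 0 0 0 p s = 1 := by
  induction s using Nat.twoStepInduction with
  | zero => simp [alSalamChihara]
  | one => simp [alSalamChihara]
  | more s _ ih => simp [alSalamChihara, ih]

theorem alSalamChihara_succ_eq_mul_left (s : ℕ) :
    alSalamChihara A C E p (s + 1) = alSalamChihara (A * p) C E p (s + 1) +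
      A * (1 - p ^ (s + 1)) * alSalamChihara (A * p) C E p s := by
  induction s using Nat.twoStepInduction with
  | zero => simp only [alSalamChihara]; ring
  | one => simp only [alSalamChihara]; ring
  | more s ih₁ ih₂ =>
    rw [alSalamChihara, ih₁, ih₂]
    simp only [alSalamChihara]
    ring

theorem alSalamChihara_succ_eq_mul_right (s : ℕ) :
    alSalamChihara A C E p (s + 1) = alSalamChihara A C (E * p) p (s + 1) +
      E * (1 - p ^ (s + 1)) * alSalamChihara A C (E * p) p s := by
  simpa only [alSalamChihara_swap A] using alSalamChihara_succ_eq_mul_left E C A p s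

theorem alSalamChihara_mul_middle_succ (s : ℕ) :
    alSalamChihara A (C * p) E p (s + 1) = alSalamChihara A C E p (s + 1) -
      C * (1 - p ^ (s + 1)) * alSalamChihara A C E p s := by
  induction s using Nat.twoStepInduction with
  | zero => simp only [alSalamChihara]; ring
  | one => simp only [alSalamChihara]; ring
  | more s ih₁ ih₂ =>
    rw [alSalamChihara, ih₁, ih₂]
    simp only [alSalamChihara]
    ring

end AlSalamChihara

section AdicLimit

variable {R : Type*} [CommRing R] {I : Ideal R} {A C p : R}

theorem pow_eq_zero_of_mem_of_pow_eq_bot {K n : ℕ} {x : R} (hI : I ^ K = ⊥) (hx : x ∈ I)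
    (hn : K ≤ n) : x ^ n = 0 :=
  pow_eq_zero_of_le hn ((Submodule.mem_bot R).1 (hI ▸ Ideal.pow_mem_pow hx K))

theorem alSalamChihara_succ_sub_mem_pow (hA : A ∈ I) (hC : C ∈ I) (E : R) (hp : p ∈ I) (s : ℕ) :
    alSalamChihara A C E p (s + 1) - alSalamChihara A C E p s ∈ I ^ s := by
  induction s with
  | zero => simp
  | succ s ih =>
    have hsub : alSalamChihara A C E p (s + 2) - alSalamChihara A C E p (s + 1) =
        (alSalamChihara A C E p (s + 1) - alSalamChihara A C E p s) * C +
          (p ^ s * p * ((A + E) * alSalamChihara A C E p (s + 1)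
            - (A * E * p ^ s - C) * alSalamChihara A C E p s) +
          p ^ s * A * (E * alSalamChihara A C E p s)) := by
      rw [alSalamChihara]; ring
    have hps : p ^ s ∈ I ^ s := Ideal.pow_mem_pow hp s
    rw [hsub, pow_succ]
    exact add_mem (Ideal.mul_mem_mul ih hC) (add_mem
      (Ideal.mul_mem_right _ _ (Ideal.mul_mem_mul hps hp))
      (Ideal.mul_mem_right _ _ (Ideal.mul_mem_mul hps hA)))

theorem alSalamChihara_eq_of_le {K s : ℕ} (hI : I ^ K = ⊥) (hA : A ∈ I) (hC : C ∈ I) (E : R)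
    (hp : p ∈ I) (hs : K ≤ s) : alSalamChihara A C E p s = alSalamChihara A C E p K := by
  induction s, hs using Nat.le_induction with
  | base => rfl
  | succ s hs ih =>
    have hsub := Ideal.pow_le_pow_right hs (alSalamChihara_succ_sub_mem_pow hA hC E hp s)
    rw [hI, Submodule.mem_bot, sub_eq_zero] at hsub
    rw [hsub, ih]

/- Once the polynomials are stationary and `p ^ (K + 1) = 0`, the contiguous relations turn into
`G(A) = (1 + A) G(A p)`, `G(E) = (1 + E) G(E p)` and `G(C p) = (1 - C) G(C)`. -/
theorem alSalamChihara_mul_one_sub {K : ℕ} (hI : I ^ K = ⊥) (hA : A ∈ I) (hC : C ∈ I) (E : R)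
    (hp : p ∈ I) :
    alSalamChihara A C E p K * (1 - C) =
      (1 + A) * (1 + E) * alSalamChihara (A * p) (C * p) (E * p) p K := by
  have hAp : A * p ∈ I := I.mul_mem_right p hA
  have hCp : C * p ∈ I := I.mul_mem_right p hC
  have hpK : p ^ (K + 1) = 0 := pow_eq_zero_of_mem_of_pow_eq_bot hI hp K.le_succ
  have hleft := alSalamChihara_succ_eq_mul_left A C E p K
  have hright := alSalamChihara_succ_eq_mul_right (A * p) C E p K
  have hmiddle := alSalamChihara_mul_middle_succ (A * p) C (E * p) p K
  rw [hpK, alSalamChihara_eq_of_le hI hA hC _ hp K.le_succ,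
    alSalamChihara_eq_of_le hI hAp hC _ hp K.le_succ] at hleft
  rw [hpK, alSalamChihara_eq_of_le hI hAp hC _ hp K.le_succ,
    alSalamChihara_eq_of_le hI hAp hC _ hp K.le_succ] at hright
  rw [hpK, alSalamChihara_eq_of_le hI hAp hCp _ hp K.le_succ,
    alSalamChihara_eq_of_le hI hAp hC _ hp K.le_succ] at hmiddle
  linear_combination (1 - C) * hleft + (1 - C) * (1 + A) * hright - (1 + A) * (1 + E) * hmiddle

theorem alSalamChihara_mul_qPoch {K : ℕ} (hI : I ^ K = ⊥) (hA : A ∈ I) (hC : C ∈ I) (E : R)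
    (hp : p ∈ I) (N : ℕ) :
    alSalamChihara A C E p K * qPoch C p N =
      qPoch (-A) p N * qPoch (-E) p N *
        alSalamChihara (A * p ^ N) (C * p ^ N) (E * p ^ N) p K := by
  induction N with
  | zero => simp [qPoch_zero]
  | succ N ih =>
    have hshift := alSalamChihara_mul_one_sub hI (I.mul_mem_right (p ^ N) hA)
      (I.mul_mem_right (p ^ N) hC) (E * p ^ N) hp
    simp only [qPoch_succ, pow_succ, ← mul_assoc]
    linear_combination (1 - C * p ^ N) * ih + qPoch (-A) p N * qPoch (-E) p N * hshift

theorem alSalamChihara_mul_qPoch_of_pow_eq_bot {K s N : ℕ} (hI : I ^ K = ⊥) (hA : A ∈ I)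
    (hC : C ∈ I) (E : R) (hp : p ∈ I) (hs : K ≤ s) (hN : K ≤ N) :
    alSalamChihara A C E p s * qPoch C p N = qPoch (-A) p N * qPoch (-E) p N := by
  rw [alSalamChihara_eq_of_le hI hA hC E hp hs, alSalamChihara_mul_qPoch hI hA hC E hp N,
    pow_eq_zero_of_mem_of_pow_eq_bot hI hp hN]
  simp only [mul_zero, alSalamChihara_zero_zero_zero, mul_one]

theorem alSalamChihara_mul_qPoch_sub_mem_pow {K s N : ℕ} (hA : A ∈ I) (hC : C ∈ I) (E : R)
    (hp : p ∈ I) (hs : K ≤ s) (hN : K ≤ N) :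
    alSalamChihara A C E p s * qPoch C p N - qPoch (-A) p N * qPoch (-E) p N ∈ I ^ K := by
  let f := Ideal.Quotient.mk (I ^ K)
  have hI : I.map f ^ K = ⊥ := by rw [← Ideal.map_pow, Ideal.map_quotient_self]
  rw [← Ideal.Quotient.eq]
  change f _ = f _
  simp only [map_mul, map_alSalamChihara, map_qPoch, map_neg]
  exact alSalamChihara_mul_qPoch_of_pow_eq_bot hI (Ideal.mem_map_of_mem f hA)
    (Ideal.mem_map_of_mem f hC) (f E) (Ideal.mem_map_of_mem f hp) hs hN

end AdicLimit

section Weights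

open MvPowerSeries

/-- The monomial in `a = X 1`, `c = X 2` and `d = X 3` recording which of the residues `1`, `2`
and `r` modulo `M` the part `x` has. -/
noncomputable def partLabel (M r x : ℕ) : MvPowerSeries (Fin 4) ℤ :=
  (if x ≡ 1 [MOD M] then X 1 else 1) * (if x ≡ 2 [MOD M] then X 2 else 1) *
    if x ≡ r [MOD M] then X 3 else 1

/-- The weight `q ^ x` of a part `x`, with `q = X 0`, decorated with its label. -/
noncomputable def partMonomial (M r x : ℕ) : MvPowerSeries (Fin 4) ℤ :=
  X 0 ^ x * partLabel M r x

theorem prod_map_ite_eq_pow_countP {α N : Type*} [CommMonoid N] (P : α → Prop) [DecidablePred P]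
    (y : N) (s : Multiset α) : (s.map fun x => if P x then y else 1).prod = y ^ s.countP P := by
  induction s using Multiset.induction with
  | empty => simp
  | cons x s ih => by_cases hx : P x <;> simp [hx, ih, pow_succ']

theorem prod_map_pow_eq_pow_sum {N : Type*} [CommMonoid N] (y : N) (s : Multiset ℕ) :
    (s.map (y ^ ·)).prod = y ^ s.sum := by
  induction s using Multiset.induction with
  | empty => simp
  | cons x s ih => simp [ih, pow_add]

theorem prod_map_partMonomial (M r : ℕ) (s : Multiset ℕ) :
    (s.map (partMonomial M r)).prod = X 0 ^ s.sum * (X 1 ^ s.countP (· ≡ 1 [MOD M]) *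
      X 2 ^ s.countP (· ≡ 2 [MOD M]) * X 3 ^ s.countP (· ≡ r [MOD M])) := by
  unfold partMonomial partLabel
  simp only [Multiset.prod_map_mul, prod_map_ite_eq_pow_countP, prod_map_pow_eq_pow_sum]

theorem coeff_prod_map_partMonomial (M r : ℕ) (s : Multiset ℕ) (e : Fin 4 →₀ ℕ) :
    coeff e (s.map (partMonomial M r)).prod =
      if s.sum = e 0 ∧ s.countP (· ≡ 1 [MOD M]) = e 1 ∧ s.countP (· ≡ 2 [MOD M]) = e 2 ∧
        s.countP (· ≡ r [MOD M]) = e 3 then 1 else 0 := by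
  simp only [prod_map_partMonomial, X_pow_eq, monomial_mul_monomial, mul_one, coeff_monomial]
  congr 1
  simp [Finsupp.ext_iff, Fin.forall_fin_succ, eq_comm]

theorem coeff_prod_map_partMonomial_eq_zero {M r : ℕ} {s : Multiset ℕ} {e : Fin 4 →₀ ℕ}
    (h : s.sum ≠ e 0) : coeff e (s.map (partMonomial M r)).prod = 0 := by
  rw [coeff_prod_map_partMonomial, if_neg (mt And.left h)]

/-- The generating function of the partitions whose multiset of parts satisfies `P`, in which `q`,
`a`, `c` and `d` count the size and the parts congruent to `1`, `2` and `r` modulo `M`. -/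
noncomputable def partitionGenFun (M r : ℕ) (P : Multiset ℕ → Prop) [DecidablePred P] :
    MvPowerSeries (Fin 4) ℤ :=
  fun e => ((Finset.univ.filter fun p : (e 0).Partition => numPartsMod p M 1 = e 1 ∧
    numPartsMod p M 2 = e 2 ∧ numPartsMod p M r = e 3 ∧ P p.parts).card : ℤ)

theorem hasSum_partitionGenFun (M r : ℕ) (P : Multiset ℕ → Prop) [DecidablePred P] :
    HasSum (fun p : Σ n : ℕ, n.Partition =>
      if P p.2.parts then (p.2.parts.map (partMonomial M r)).prod else 0)
      (partitionGenFun M r P) := by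
  refine (WithPiTopology.hasSum_iff_hasSum_coeff ..).2 fun e => ?_
  have hcoeff : ∀ p ∉ Finset.univ.map (Function.Embedding.sigmaMk (β := Nat.Partition) (e 0)),
      coeff e (if P p.2.parts then (p.2.parts.map (partMonomial M r)).prod else 0) = 0 := by
    rintro ⟨n, p⟩ hp
    have hn : p.parts.sum ≠ e 0 := by
      intro h
      obtain rfl := p.parts_sum.symm.trans h
      simp at hp
    split_ifs
    · exact coeff_prod_map_partMonomial_eq_zero hn
    · exact map_zero _
  suffices hsum : coeff e (partitionGenFun M r P) = _ from
    hsum ▸ hasSum_sum_of_ne_finset_zero hcoeff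
  rw [Finset.sum_map, coeff_apply, partitionGenFun, Finset.card_filter, Nat.cast_sum]
  refine Finset.sum_congr rfl fun p _ => ?_
  change _ = coeff e (if P p.parts then (p.parts.map (partMonomial M r)).prod else 0)
  by_cases hP : P p.parts <;> simp [coeff_prod_map_partMonomial, numPartsMod, hP, p.parts_sum]

end Weights

section ListGenFun

open MvPowerSeries

/-- The product of the weights `partMonomial 4 3` of the members of a list, which records the list
in the generating function of the numbers `A4`. -/
noncomputable def listMonomial (l : List ℕ) : MvPowerSeries (Fin 4) ℤ :=
  (l.map (partMonomial 4 3)).prod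

theorem listMonomial_cons (x : ℕ) (l : List ℕ) :
    listMonomial (x :: l) = partMonomial 4 3 x * listMonomial l := by
  rw [listMonomial, List.map_cons, List.prod_cons, listMonomial]

theorem prod_map_partMonomial_coe (l : List ℕ) :
    ((l : Multiset ℕ).map (partMonomial 4 3)).prod = listMonomial l := by
  rw [Multiset.map_coe, Multiset.prod_coe, listMonomial]

/-- The generating function of a set of lists, each weighted by `listMonomial`. As a `tsum`, it
vanishes by convention if the sum does not converge. -/
noncomputable def listGenFun (S : Set (List ℕ)) : MvPowerSeries (Fin 4) ℤ :=
  ∑' l : S, listMonomial l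

theorem finite_setOf_length_eq_and_sum_eq (s n : ℕ) :
    {l : List ℕ | l.length = s ∧ l.sum = n}.Finite := by
  refine ((List.finite_length_eq (Fin (n + 1)) s).image (List.map Fin.val)).subset ?_
  rintro l ⟨hl, hn⟩
  have hlt : ∀ x ∈ l, x < n + 1 := fun x hx => by
    have := List.single_le_sum (fun _ _ => Nat.zero_le _) x hx
    omega
  exact ⟨l.pmap Fin.mk hlt, by simpa using hl, by simp [List.map_pmap]⟩

theorem summable_listMonomial {S : Set (List ℕ)} {s : ℕ} (hS : ∀ l ∈ S, l.length = s) :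
    Summable fun l : S => listMonomial l := by
  refine (WithPiTopology.summable_iff_summable_coeff ..).2 fun e =>
    summable_of_hasFiniteSupport ?_
  refine ((finite_setOf_length_eq_and_sum_eq s (e 0)).preimage
    Subtype.val_injective.injOn).subset fun l hl => ⟨hS l l.2, ?_⟩
  rw [Function.mem_support, ← prod_map_partMonomial_coe] at hl
  rw [← Multiset.sum_coe]
  exact not_imp_comm.1 coeff_prod_map_partMonomial_eq_zero hl

theorem listGenFun_union {S T : Set (List ℕ)} {s : ℕ} (hST : Disjoint S T)
    (hS : ∀ l ∈ S, l.length = s) (hT : ∀ l ∈ T, l.length = s) :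
    listGenFun (S ∪ T) = listGenFun S + listGenFun T :=
  (summable_listMonomial hS).tsum_union_disjoint hST (summable_listMonomial hT)

theorem listGenFun_image {S : Set (List ℕ)} {s : ℕ} (hS : ∀ l ∈ S, l.length = s)
    {g : List ℕ → List ℕ} (hg : Function.Injective g) {w : MvPowerSeries (Fin 4) ℤ}
    (hw : ∀ l ∈ S, listMonomial (g l) = w * listMonomial l) :
    listGenFun (g '' S) = w * listGenFun S := by
  rw [listGenFun, tsum_image _ hg.injOn, tsum_congr fun l : S => hw l l.2,
    (summable_listMonomial hS).tsum_mul_left, listGenFun]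

theorem listGenFun_iUnion_cons (Y : Finset ℕ) {S : ℕ → Set (List ℕ)} {s : ℕ}
    (hS : ∀ y, ∀ l ∈ S y, l.length = s) :
    listGenFun (⋃ y ∈ Y, List.cons y '' S y) = ∑ y ∈ Y, partMonomial 4 3 y * listGenFun (S y) := by
  have hdisj : (Y : Set ℕ).PairwiseDisjoint fun y => List.cons y '' S y := by
    intro y _ z _ hyz
    rw [Function.onFun, Set.disjoint_left]
    rintro _ ⟨l, -, rfl⟩ ⟨l', -, h⟩
    exact hyz (List.cons.inj h).1.symm
  have hlength : ∀ y, ∀ l ∈ List.cons y '' S y, l.length = s + 1 := by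
    rintro y _ ⟨l, hl, rfl⟩
    rw [List.length_cons, hS y l hl]
  calc listGenFun (⋃ y ∈ Y, List.cons y '' S y)
    _ = ∑ y ∈ Y, listGenFun (List.cons y '' S y) :=
      Summable.tsum_finset_bUnion_disjoint hdisj fun y _ => summable_listMonomial (hlength y)
    _ = ∑ y ∈ Y, partMonomial 4 3 y * listGenFun (S y) :=
      Finset.sum_congr rfl fun y _ =>
        listGenFun_image (hS y) List.cons_injective fun l _ => listMonomial_cons y l

end ListGenFun

section GapLists

/-- The relation between a part `x` and the next larger part `y` of the partitions counted by
`A4`. -/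
def GapRel (x y : ℕ) : Prop := x ≤ y ∧ GapCondition y x

theorem gapRel_add_four {x y : ℕ} : GapRel (x + 4) (y + 4) ↔ GapRel x y := by
  unfold GapRel GapCondition; omega

theorem GapRel.of_add_four {x y : ℕ} (h : GapRel (x + 4) y) : GapRel x y := by
  unfold GapRel GapCondition at *; omega

/-- The lists of `s` numbers which, preceded by `x`, are chains for `GapRel`. -/
def gapLists (s x : ℕ) : Set (List ℕ) := {l | l.length = s ∧ (x :: l).IsChain GapRel}

theorem length_of_mem_gapLists {s x : ℕ} : ∀ l ∈ gapLists s x, l.length = s :=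
  fun _ hl => hl.1

theorem gapLists_zero (x : ℕ) : gapLists 0 x = {[]} := by
  ext l
  simp only [gapLists, Set.mem_ofPred_eq, Set.mem_singleton_iff, List.length_eq_zero_iff]
  exact ⟨And.left, by rintro rfl; simp⟩

theorem cons_mem_gapLists {s x y : ℕ} {l : List ℕ} :
    y :: l ∈ gapLists (s + 1) x ↔ GapRel x y ∧ l ∈ gapLists s y := by
  simp only [gapLists, Set.mem_ofPred_eq, List.length_cons, List.isChain_cons_cons,
    Nat.add_right_cancel_iff]
  tauto

theorem mem_gapLists_succ {s x : ℕ} {l : List ℕ} :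
    l ∈ gapLists (s + 1) x ↔ ∃ y l', l = y :: l' ∧ GapRel x y ∧ l' ∈ gapLists s y := by
  cases l with
  | nil => simp [gapLists]
  | cons y l => simp [cons_mem_gapLists]

theorem gapLists_congr (s : ℕ) {x x' : ℕ} (h : ∀ y, GapRel x y ↔ GapRel x' y) :
    gapLists s x = gapLists s x' := by
  cases s with
  | zero => rw [gapLists_zero, gapLists_zero]
  | succ s => ext l; simp only [mem_gapLists_succ, h]

theorem gapLists_add_four (s x : ℕ) :
    gapLists s (x + 4) = List.map (· + 4) '' gapLists s x := by
  induction s generalizing x with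
  | zero => simp [gapLists_zero]
  | succ s ih =>
    ext l
    simp only [Set.mem_image, mem_gapLists_succ]
    constructor
    · rintro ⟨y, l, rfl, hy, hl⟩
      obtain ⟨y, rfl⟩ : ∃ z, y = z + 4 := ⟨y - 4, by have := hy.1; omega⟩
      rw [ih] at hl
      obtain ⟨l, hl, rfl⟩ := hl
      exact ⟨y :: l, ⟨y, l, rfl, gapRel_add_four.1 hy, hl⟩, rfl⟩
    · rintro ⟨_, ⟨y, l, rfl, hy, hl⟩, rfl⟩
      refine ⟨y + 4, l.map (· + 4), rfl, gapRel_add_four.2 hy, ?_⟩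
      rw [ih]
      exact ⟨l, hl, rfl⟩

theorem gapLists_succ_eq_union (s x : ℕ) (Y : Finset ℕ)
    (hY : ∀ y, y ∈ Y ↔ GapRel x y ∧ ¬ GapRel (x + 4) y) :
    gapLists (s + 1) x = gapLists (s + 1) (x + 4) ∪ ⋃ y ∈ Y, List.cons y '' gapLists s y := by
  ext l
  cases l with
  | nil => simp [gapLists]
  | cons z l =>
    simp only [Set.mem_union, cons_mem_gapLists, Set.mem_iUnion, Set.mem_image, List.cons.injEq,
      exists_prop]
    constructor
    · rintro ⟨hz, hl⟩
      by_cases h : GapRel (x + 4) z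
      · exact Or.inl ⟨h, hl⟩
      · exact Or.inr ⟨z, (hY z).2 ⟨hz, h⟩, l, hl, rfl, rfl⟩
    · rintro (⟨hz, hl⟩ | ⟨y, hy, l, hl, rfl, rfl⟩)
      · exact ⟨hz.of_add_four, hl⟩
      · exact ⟨((hY y).1 hy).1, hl⟩

end GapLists

section GapGenFun

open MvPowerSeries

/-- The generating function of `gapLists s x`. -/
noncomputable def gapGenFun (s x : ℕ) : MvPowerSeries (Fin 4) ℤ :=
  listGenFun (gapLists s x)

theorem gapGenFun_zero (x : ℕ) : gapGenFun 0 x = 1 := by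
  rw [gapGenFun, gapLists_zero, listGenFun, tsum_singleton]
  exact List.prod_nil

theorem partMonomial_add_four (x : ℕ) :
    partMonomial 4 3 (x + 4) = X 0 ^ 4 * partMonomial 4 3 x := by
  have hmod (r : ℕ) : x + 4 ≡ r [MOD 4] ↔ x ≡ r [MOD 4] := by
    unfold Nat.ModEq; omega
  simp only [partMonomial, partLabel, hmod]
  ring

theorem listMonomial_map_add_four (l : List ℕ) :
    listMonomial (l.map (· + 4)) = (X 0 ^ 4) ^ l.length * listMonomial l := by
  induction l with
  | nil => simp [listMonomial]
  | cons x l ih =>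
    rw [List.map_cons, listMonomial_cons, listMonomial_cons, ih, partMonomial_add_four,
      List.length_cons]
    ring

theorem gapGenFun_congr (s : ℕ) {x x' : ℕ} (h : ∀ y, GapRel x y ↔ GapRel x' y) :
    gapGenFun s x = gapGenFun s x' := by
  rw [gapGenFun, gapLists_congr s h, gapGenFun]

theorem gapGenFun_add_four (s x : ℕ) : gapGenFun s (x + 4) = (X 0 ^ 4) ^ s * gapGenFun s x := by
  rw [gapGenFun, gapLists_add_four]
  refine listGenFun_image length_of_mem_gapLists
    (List.map_injective_iff.2 (add_left_injective 4)) fun l hl => ?_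
  rw [listMonomial_map_add_four, hl.1]

theorem gapGenFun_succ (s x : ℕ) (Y : Finset ℕ)
    (hY : ∀ y, y ∈ Y ↔ GapRel x y ∧ ¬ GapRel (x + 4) y) :
    (1 - (X 0 ^ 4) ^ (s + 1)) * gapGenFun (s + 1) x =
      ∑ y ∈ Y, partMonomial 4 3 y * gapGenFun s y := by
  have hunion := gapLists_succ_eq_union s x Y hY
  have hdisj : Disjoint (gapLists (s + 1) (x + 4)) (⋃ y ∈ Y, List.cons y '' gapLists s y) := by
    rw [Set.disjoint_iUnion₂_right]
    intro y hy
    rw [Set.disjoint_right]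
    rintro _ ⟨l, -, rfl⟩ hl
    exact ((hY y).1 hy).2 (cons_mem_gapLists.1 hl).1
  have hsub : (⋃ y ∈ Y, List.cons y '' gapLists s y) ⊆ gapLists (s + 1) x :=
    hunion ▸ Set.subset_union_right
  have hsum : gapGenFun (s + 1) x = gapGenFun (s + 1) (x + 4) +
      ∑ y ∈ Y, partMonomial 4 3 y * gapGenFun s y := by
    rw [gapGenFun, hunion, listGenFun_union hdisj length_of_mem_gapLists fun l hl =>
      length_of_mem_gapLists l (hsub hl), listGenFun_iUnion_cons Y fun y => length_of_mem_gapLists]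
    rfl
  rw [gapGenFun_add_four] at hsum
  linear_combination hsum

theorem gapGenFun_two (s : ℕ) : gapGenFun s 2 = gapGenFun s 1 :=
  gapGenFun_congr s fun y => by unfold GapRel GapCondition; omega

theorem gapGenFun_three (s : ℕ) : gapGenFun s 3 = (X 0 ^ 4) ^ s * gapGenFun s 0 := by
  rw [← gapGenFun_add_four]
  exact gapGenFun_congr s fun y => by unfold GapRel GapCondition; omega

theorem gapGenFun_seven (s : ℕ) :
    gapGenFun s 7 = (X 0 ^ 4) ^ s * ((X 0 ^ 4) ^ s * gapGenFun s 0) := by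
  rw [gapGenFun_add_four s 3, gapGenFun_three]

local notation "q" => (X 0 : MvPowerSeries (Fin 4) ℤ)
local notation "a" => (X 1 : MvPowerSeries (Fin 4) ℤ)
local notation "c" => (X 2 : MvPowerSeries (Fin 4) ℤ)
local notation "d" => (X 3 : MvPowerSeries (Fin 4) ℤ)

theorem gapGenFun_succ_zero (s : ℕ) :
    (1 - (q ^ 4) ^ (s + 1)) * gapGenFun (s + 1) 0 =
      (1 + d * q ^ 7 * (q ^ 8) ^ s) * gapGenFun s 0 + (a * q + c * q ^ 2) * gapGenFun s 1 := by
  rw [gapGenFun_succ s 0 {0, 1, 2, 7} fun y => by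
    rw [Finset.mem_insert, Finset.mem_insert, Finset.mem_insert, Finset.mem_singleton, GapRel,
      GapRel, GapCondition, GapCondition]
    omega]
  simp only [Finset.sum_insert, Finset.sum_singleton, Finset.mem_insert, Finset.mem_singleton,
    Nat.reduceEqDiff, OfNat.zero_ne_ofNat, OfNat.one_ne_ofNat, zero_ne_one, or_self,
    not_false_eq_true, partMonomial, partLabel, Nat.ModEq, Nat.reduceMod, Nat.zero_mod,
    Nat.one_mod, OfNat.ofNat_ne_one, if_true, if_false, gapGenFun_two, gapGenFun_seven]
  ring

theorem gapGenFun_succ_one (s : ℕ) :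
    (1 - (q ^ 4) ^ (s + 1)) * gapGenFun (s + 1) 1 =
      ((q ^ 8) ^ (s + 1) + d * q ^ 7 * (q ^ 8) ^ s) * gapGenFun s 0 +
        (a * q * (q ^ 8) ^ (s + 1) + c * q ^ 2) * gapGenFun s 1 := by
  have h8 : gapGenFun s 8 = (q ^ 4) ^ s * ((q ^ 4) ^ s * gapGenFun s 0) := by
    rw [gapGenFun_add_four s 4, gapGenFun_add_four s 0]
  have h9 : gapGenFun s 9 = (q ^ 4) ^ s * ((q ^ 4) ^ s * gapGenFun s 1) := by
    rw [gapGenFun_add_four s 5, gapGenFun_add_four s 1]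
  rw [gapGenFun_succ s 1 {2, 7, 8, 9} fun y => by
    rw [Finset.mem_insert, Finset.mem_insert, Finset.mem_insert, Finset.mem_singleton, GapRel,
      GapRel, GapCondition, GapCondition]
    omega]
  simp only [Finset.sum_insert, Finset.sum_singleton, Finset.mem_insert, Finset.mem_singleton,
    Nat.reduceEqDiff, or_self, not_false_eq_true, partMonomial, partLabel, Nat.ModEq,
    Nat.reduceMod, Nat.one_mod, OfNat.ofNat_ne_one, OfNat.zero_ne_ofNat, OfNat.one_ne_ofNat,
    zero_ne_one, if_true, if_false, gapGenFun_two, gapGenFun_seven, h8, h9]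
  ring

theorem qPoch_mul_gapGenFun_zero (s : ℕ) :
    qPoch (q ^ 4) (q ^ 4) s * gapGenFun s 0 =
      alSalamChihara (a * q) (c * q ^ 2) (d * q ^ 7) (q ^ 8) s := by
  have hzero (s : ℕ) : qPoch (q ^ 4) (q ^ 4) (s + 1) * gapGenFun (s + 1) 0 =
      (1 + d * q ^ 7 * (q ^ 8) ^ s) * (qPoch (q ^ 4) (q ^ 4) s * gapGenFun s 0) +
        (a * q + c * q ^ 2) * (qPoch (q ^ 4) (q ^ 4) s * gapGenFun s 1) := by
    rw [qPoch_succ]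
    linear_combination qPoch (q ^ 4) (q ^ 4) s * gapGenFun_succ_zero s
  have hone (s : ℕ) : qPoch (q ^ 4) (q ^ 4) (s + 1) * gapGenFun (s + 1) 1 =
      ((q ^ 8) ^ (s + 1) + d * q ^ 7 * (q ^ 8) ^ s) * (qPoch (q ^ 4) (q ^ 4) s * gapGenFun s 0) +
        (a * q * (q ^ 8) ^ (s + 1) + c * q ^ 2) * (qPoch (q ^ 4) (q ^ 4) s * gapGenFun s 1) := by
    rw [qPoch_succ]
    linear_combination qPoch (q ^ 4) (q ^ 4) s * gapGenFun_succ_one s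
  induction s using Nat.twoStepInduction with
  | zero => rw [qPoch_zero, gapGenFun_zero, alSalamChihara, one_mul]
  | one =>
    rw [hzero 0, qPoch_zero, gapGenFun_zero, gapGenFun_zero, alSalamChihara]
    ring
  | more s ih₁ ih₂ =>
    rw [alSalamChihara, ← ih₁, ← ih₂, hzero (s + 1), hone s]
    linear_combination (-(a * q * (q ^ 8) ^ (s + 1)) - c * q ^ 2) * hzero s

end GapGenFun

section ChainLists

theorem exists_rel_of_isChain_cons {α : Type*} {r : α → α → Prop} {x y : α} {l : List α}
    (h : (x :: l).IsChain r) (hy : y ∈ l) : ∃ z, r z y := by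
  induction l generalizing x with grind

theorem isChain_and {α : Type*} {r r' : α → α → Prop} {l : List α} (h : l.IsChain r)
    (h' : l.IsChain r') : l.IsChain fun x y => r x y ∧ r' x y := by
  induction l with grind [List.isChain_cons]

theorem pairwise_le_of_isChain_gapRel {l : List ℕ} (h : l.IsChain GapRel) :
    l.Pairwise (· ≤ ·) :=
  List.isChain_iff_pairwise.1 (h.imp fun _ _ => And.left)

-- A leading `0` forces the smallest part to differ from `3`, and nothing else.
theorem isChain_gapRel_zero_cons_reverse {l : List ℕ} (hl : l.Pairwise (· ≥ ·)) :
    (0 :: l.reverse).IsChain GapRel ↔ 3 ∉ l ∧ l.IsChain GapCondition := by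
  have hreverse : l.reverse.IsChain GapRel ↔ l.IsChain GapCondition := by
    rw [← List.isChain_reverse (l := l)]
    exact ⟨fun h => h.imp fun _ _ => And.right,
      isChain_and (List.pairwise_reverse.2 hl).isChain⟩
  constructor
  · refine fun h => ⟨fun h3 => ?_, hreverse.1 h.tail⟩
    obtain ⟨z, hz⟩ := exists_rel_of_isChain_cons h (List.mem_reverse.2 h3)
    unfold GapRel GapCondition at hz
    omega
  · rintro ⟨h3, h⟩
    refine List.isChain_cons.2 ⟨fun y hy => ?_, hreverse.2 h⟩
    have hy3 : y ≠ 3 := fun h => h3 (h ▸ List.mem_reverse.1 (List.mem_of_mem_head? hy))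
    unfold GapRel GapCondition
    omega

/-- The partitions counted by the numbers `A4`, as increasing lists of positive parts. -/
def gapPartitions : Set (List ℕ) := {l | (0 :: l).IsChain GapRel ∧ 0 ∉ l}

theorem reverse_sort_mem_gapPartitions {n : ℕ} (p : n.Partition) :
    (p.parts.sort (· ≥ ·)).reverse ∈ gapPartitions ↔
      3 ∉ p.parts ∧ (p.parts.sort (· ≥ ·)).IsChain GapCondition := by
  have hzero : 0 ∉ p.parts := fun h => (p.parts_pos h).ne rfl
  simp [gapPartitions, isChain_gapRel_zero_cons_reverse (Multiset.pairwise_sort _ _), hzero]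

theorem exists_partition_of_mem_gapPartitions {l : List ℕ} (hl : l ∈ gapPartitions) :
    ∃ p : Σ n : ℕ, n.Partition, (p.2.parts.sort (· ≥ ·)).reverse = l := by
  refine ⟨⟨_, ⟨l, fun {x} hx => Nat.pos_of_ne_zero fun h => hl.2 (h ▸ hx), rfl⟩⟩, ?_⟩
  refine List.Perm.eq_of_pairwise' (r := (· ≤ ·))
    (List.pairwise_reverse.2 (Multiset.pairwise_sort _ _))
    (pairwise_le_of_isChain_gapRel hl.1).tail (Multiset.coe_eq_coe.1 ?_)
  rw [Multiset.coe_reverse, Multiset.sort_eq]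

theorem reverse_sort_parts_injective : Function.Injective
    fun p : Σ n : ℕ, n.Partition => (p.2.parts.sort (· ≥ ·)).reverse := by
  rintro ⟨n, p⟩ ⟨m, p'⟩ h
  have hparts : p.parts = p'.parts := by
    rw [← p.parts.sort_eq (· ≥ ·), ← p'.parts.sort_eq (· ≥ ·), List.reverse_injective h]
  obtain rfl : n = m := by rw [← p.parts_sum, ← p'.parts_sum, hparts]
  rw [Nat.Partition.ext hparts]

theorem A4GenFun_eq_partitionGenFun :
    A4GenFun = partitionGenFun 4 3 fun s => 3 ∉ s ∧ (s.sort (· ≥ ·)).IsChain GapCondition :=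
  rfl

theorem hasSum_gapPartitions :
    HasSum (gapPartitions.indicator listMonomial) A4GenFun := by
  classical
  refine (reverse_sort_parts_injective.hasSum_iff fun l hl => ?_).1 ?_
  · refine Set.indicator_of_notMem (fun h => hl ?_) _
    exact exists_partition_of_mem_gapPartitions h
  · rw [A4GenFun_eq_partitionGenFun]
    convert hasSum_partitionGenFun 4 3 fun s => 3 ∉ s ∧ (s.sort (· ≥ ·)).IsChain GapCondition
      using 2 with p
    rw [Function.comp_apply, Set.indicator_apply, ← prod_map_partMonomial_coe,
      Multiset.coe_reverse, Multiset.sort_eq]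
    simp only [reverse_sort_mem_gapPartitions]

theorem gapLists_succ_zero (s : ℕ) :
    gapLists (s + 1) 0 =
      List.cons 0 '' gapLists s 0 ∪ {l ∈ gapPartitions | l.length = s + 1} := by
  ext l
  rcases l with _ | ⟨_ | y, l⟩
  · simp [gapLists]
  · have hrel : GapRel 0 0 := by simp [GapRel, GapCondition]
    simp [cons_mem_gapLists, gapPartitions, hrel]
  · have hpos (h : (0 :: (y + 1) :: l).IsChain GapRel) : 0 ∉ (y + 1) :: l := by
      have hle := pairwise_le_of_isChain_gapRel h.tail
      exact fun h0 => by simpa using (List.pairwise_cons.1 hle).1 0 (by simpa using h0)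
    simp only [gapLists, gapPartitions, Set.mem_union, Set.mem_image, Set.mem_ofPred_eq]
    refine ⟨fun h => Or.inr ⟨⟨h.2, hpos h.2⟩, h.1⟩, ?_⟩
    rintro (⟨_, -, h⟩ | h)
    · simp at h
    · exact ⟨h.2, h.1.1⟩

theorem disjoint_image_cons_zero_gapPartitions (S : Set (List ℕ)) (s : ℕ) :
    Disjoint (List.cons 0 '' S) {l ∈ gapPartitions | l.length = s} := by
  rw [Set.disjoint_left]
  rintro _ ⟨l, -, rfl⟩ hl
  exact hl.1.2 List.mem_cons_self

theorem gapGenFun_zero_eq_sum (s : ℕ) :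
    gapGenFun s 0 =
      ∑ j ∈ Finset.range (s + 1), listGenFun {l ∈ gapPartitions | l.length = j} := by
  induction s with
  | zero =>
    rw [Finset.sum_range_one, gapGenFun, gapLists_zero]
    congr 1
    ext l
    simp +contextual [gapPartitions, List.length_eq_zero_iff]
  | succ s ih =>
    have himage : listGenFun (List.cons 0 '' gapLists s 0) = 1 * gapGenFun s 0 :=
      listGenFun_image length_of_mem_gapLists List.cons_injective fun l _ => by
        rw [listMonomial_cons]; simp [partMonomial, partLabel, Nat.ModEq]
    rw [gapGenFun, gapLists_succ_zero, listGenFun_union (s := s + 1)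
      (disjoint_image_cons_zero_gapPartitions _ _) _ fun l hl => hl.2, himage, one_mul, ih,
      Finset.sum_range_succ _ (s + 1)]
    rintro _ ⟨l, hl, rfl⟩
    rw [List.length_cons, hl.1]

open Filter Topology

theorem tendsto_gapGenFun_zero : Tendsto (fun s => gapGenFun s 0) atTop (𝓝 A4GenFun) := by
  have hfiber (j : ℕ) :
      ∑' l : List.length (α := ℕ) ⁻¹' {j}, gapPartitions.indicator listMonomial l =
        listGenFun {l ∈ gapPartitions | l.length = j} := by
    rw [listGenFun, tsum_subtype, tsum_subtype, Set.indicator_indicator, Set.inter_comm]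
    rfl
  have hsum := hasSum_gapPartitions.tsum_fiberwise List.length
  simp only [hfiber] at hsum
  simp only [gapGenFun_zero_eq_sum]
  exact hsum.tendsto_sum_nat.comp (tendsto_add_atTop_nat 1)

end ChainLists

section PartitionProduct

open scoped PowerSeries.WithPiTopology

theorem hasProd_sum_partition {R : Type*} [CommRing R] [UniformSpace R] [IsUniformAddGroup R]
    [IsTopologicalRing R] [IsLinearTopology R R] [CompleteSpace R] [T2Space R] (f : ℕ → ℕ → R)
    {x : R} (hx : IsTopologicallyNilpotent x) :
    HasProd (fun i => 1 + ∑' j, f (i + 1) (j + 1) * x ^ ((i + 1) * (j + 1)))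
      (∑' n, (∑ p : n.Partition, p.parts.toFinsupp.prod f) * x ^ n) := by
  have hX : PowerSeries.aeval hx (PowerSeries.X : PowerSeries R) = x := by
    simpa only [Polynomial.coe_X, Polynomial.aeval_X] using PowerSeries.aeval_coe hx Polynomial.X
  have hfactor (i : ℕ) : PowerSeries.aeval hx (1 + ∑' j, f (i + 1) (j + 1) •
      (PowerSeries.X : PowerSeries R) ^ ((i + 1) * (j + 1))) =
        1 + ∑' j, f (i + 1) (j + 1) * x ^ ((i + 1) * (j + 1)) := by
    rw [map_add, map_one, (Nat.Partition.summable_genFun_term f i).map_tsum _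
      (PowerSeries.continuous_aeval hx)]
    simp only [map_smul, map_pow, hX, smul_eq_mul]
  have hgenFun : PowerSeries.aeval hx (Nat.Partition.genFun f) =
      ∑' n, (∑ p : n.Partition, p.parts.toFinsupp.prod f) * x ^ n := by
    simp only [PowerSeries.aeval_eq_sum, Nat.Partition.coeff_genFun, smul_eq_mul]
  simpa only [Function.comp_def, hfactor, hgenFun] using
    (Nat.Partition.hasProd_genFun f).map _ (PowerSeries.continuous_aeval hx)

end PartitionProduct

section PartitionGenFun

open MvPowerSeries
open scoped MvPowerSeries.LinearTopology

theorem prod_toFinsupp_ite_mul_pow_sum (M r : ℕ) (Allowed : ℕ → ℕ → Prop)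
    [∀ x k, Decidable (Allowed x k)] (s : Multiset ℕ) :
    s.toFinsupp.prod (fun x k => if Allowed x k then partLabel M r x ^ k else 0) * X 0 ^ s.sum =
      if ∀ x ∈ s, Allowed x (s.count x) then (s.map (partMonomial M r)).prod else 0 := by
  rw [Finsupp.prod, Multiset.toFinsupp_support, Finset.prod_ite_zero, ite_mul, zero_mul]
  simp only [Multiset.toFinsupp_apply, Multiset.mem_toFinset, ← prod_map_pow_eq_pow_sum,
    partMonomial, mul_pow, Finset.prod_multiset_map_count, Finset.prod_mul_distrib, mul_comm]

theorem hasProd_partitionGenFun (M r : ℕ) (Allowed : ℕ → ℕ → Prop)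
    [∀ x k, Decidable (Allowed x k)] :
    HasProd (fun i => 1 + ∑' j, if Allowed (i + 1) (j + 1) then partMonomial M r (i + 1) ^ (j + 1)
      else 0) (partitionGenFun M r fun s => ∀ x ∈ s, Allowed x (s.count x)) := by
  have hX : IsTopologicallyNilpotent (X 0 : MvPowerSeries (Fin 4) ℤ) :=
    WithPiTopology.isTopologicallyNilpotent_of_constantCoeff_zero (constantCoeff_X 0)
  have hvalue := (hasSum_partitionGenFun M r fun s => ∀ x ∈ s, Allowed x (s.count x)).sigma
    fun n => hasSum_fintype _
  convert hasProd_sum_partition (fun x k => if Allowed x k then partLabel M r x ^ k else 0) hX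
    using 1
  · rfl
  · simp only [partMonomial, mul_pow, ite_mul, zero_mul, ← pow_mul,
      mul_comm (partLabel _ _ _ ^ _)]
  · refine hvalue.tsum_eq.symm.trans (tsum_congr fun n => ?_)
    rw [Finset.sum_mul]
    refine Finset.sum_congr rfl fun p _ => ?_
    rw [← prod_toFinsupp_ite_mul_pow_sum, p.parts_sum]

end PartitionGenFun

section ProductSide

open MvPowerSeries Filter Topology

/-- Part `x` with multiplicity `k` is admissible in the partitions counted by `B4`. -/
def ProductPart (x k : ℕ) : Prop := (Even x ∧ x % 8 ≠ 6) ∨ (k = 1 ∧ (x % 8 = 1 ∨ x % 8 = 7))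

instance (x k : ℕ) : Decidable (ProductPart x k) := by
  unfold ProductPart; infer_instance

/-- The generating function of the numbers `B4`, in the same variables as `A4GenFun`. -/
noncomputable def B4GenFun : MvPowerSeries (Fin 4) ℤ :=
  fun e => (B4 (e 0) (e 1) (e 2) (e 3) : ℤ)

theorem B4GenFun_eq_partitionGenFun :
    B4GenFun = partitionGenFun 8 7 fun s => ∀ x ∈ s, ProductPart x (s.count x) :=
  rfl

/-- The factor of the product for `B4GenFun` contributed by the part `x`. -/
noncomputable def partFactor (x : ℕ) : MvPowerSeries (Fin 4) ℤ :=
  1 + ∑' j, if ProductPart x (j + 1) then partMonomial 8 7 x ^ (j + 1) else 0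

theorem hasProd_partFactor : HasProd (fun i => partFactor (i + 1)) B4GenFun := by
  rw [B4GenFun_eq_partitionGenFun]
  exact hasProd_partitionGenFun 8 7 ProductPart

theorem partFactor_mul_one_sub {x : ℕ} (h0 : x ≠ 0) (hx : Even x ∧ x % 8 ≠ 6) :
    partFactor x * (1 - partMonomial 8 7 x) = 1 := by
  have hconst : constantCoeff (partMonomial 8 7 x) = 0 := by simp [partMonomial, h0]
  rw [partFactor]
  simp only [ProductPart, hx, true_and, true_or, if_true, ne_eq, not_false_eq_true]
  have h := (WithPiTopology.summable_pow_of_constantCoeff_eq_zero hconst).tsum_eq_zero_add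
  rw [pow_zero] at h
  rw [← h]
  exact WithPiTopology.tsum_pow_mul_one_sub_of_constantCoeff_eq_zero hconst

theorem partFactor_eq_one_add {x : ℕ} (hx : x % 8 = 1 ∨ x % 8 = 7) :
    partFactor x = 1 + partMonomial 8 7 x := by
  have hodd : ¬ Even x := by rw [Nat.even_iff]; omega
  rw [partFactor, tsum_eq_single 0]
  · simp [ProductPart, hx]
  · intro j hj
    simp [ProductPart, hj, hodd]

theorem partFactor_eq_one {x : ℕ} (h₁ : ¬ (Even x ∧ x % 8 ≠ 6))
    (h₂ : ¬ (x % 8 = 1 ∨ x % 8 = 7)) : partFactor x = 1 := by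
  simp only [partFactor, ProductPart, h₁, h₂, and_false, or_false, if_false, tsum_zero, add_zero]

local notation "q" => (X 0 : MvPowerSeries (Fin 4) ℤ)
local notation "a" => (X 1 : MvPowerSeries (Fin 4) ℤ)
local notation "c" => (X 2 : MvPowerSeries (Fin 4) ℤ)
local notation "d" => (X 3 : MvPowerSeries (Fin 4) ℤ)

theorem prod_partFactor_eight (M : ℕ) :
    (∏ i ∈ Finset.range 8, partFactor (8 * M + i + 1)) *
        ((1 - q ^ 4 * (q ^ 4) ^ (2 * M)) * (1 - q ^ 4 * (q ^ 4) ^ (2 * M + 1)) *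
          (1 - c * q ^ 2 * (q ^ 8) ^ M)) =
      (1 + a * q * (q ^ 8) ^ M) * (1 + d * q ^ 7 * (q ^ 8) ^ M) := by
  have h1 := partFactor_eq_one_add (x := 8 * M + 1) (by omega)
  have h2 := partFactor_mul_one_sub (x := 8 * M + 2) (by omega) (by rw [Nat.even_iff]; omega)
  have h3 := partFactor_eq_one (x := 8 * M + 3) (by rw [Nat.even_iff]; omega) (by omega)
  have h4 := partFactor_mul_one_sub (x := 8 * M + 4) (by omega) (by rw [Nat.even_iff]; omega)
  have h5 := partFactor_eq_one (x := 8 * M + 5) (by rw [Nat.even_iff]; omega) (by omega)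
  have h6 := partFactor_eq_one (x := 8 * M + 6) (by rw [Nat.even_iff]; omega) (by omega)
  have h7 := partFactor_eq_one_add (x := 8 * M + 7) (by omega)
  have h8 := partFactor_mul_one_sub (x := 8 * M + 8) (by omega) (by rw [Nat.even_iff]; omega)
  simp only [partMonomial, partLabel, Nat.ModEq, Nat.mul_add_mod, Nat.reduceMod, Nat.reduceEqDiff,
    if_true, if_false, mul_one, one_mul, OfNat.ofNat_ne_one, OfNat.zero_ne_ofNat,
    OfNat.one_ne_ofNat, zero_ne_one] at h1 h2 h4 h7 h8
  calc _
    _ = (1 + a * q * (q ^ 8) ^ M) * (1 + d * q ^ 7 * (q ^ 8) ^ M) *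
        (partFactor (8 * M + 2) * (1 - q ^ (8 * M + 2) * c)) *
        (partFactor (8 * M + 4) * (1 - q ^ (8 * M + 4))) *
        (partFactor (8 * M + 8) * (1 - q ^ (8 * M + 8))) := by
      simp only [Finset.prod_range_succ, Finset.prod_range_zero, one_mul, add_assoc,
        Nat.reduceAdd, h1, h3, h5, h6, h7]
      ring
    _ = (1 + a * q * (q ^ 8) ^ M) * (1 + d * q ^ 7 * (q ^ 8) ^ M) := by
      simp only [h2, h4, h8, mul_one]

theorem prod_partFactor_mul_qPoch (M : ℕ) :
    (∏ i ∈ Finset.range (8 * M), partFactor (i + 1)) *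
        (qPoch (q ^ 4) (q ^ 4) (2 * M) * qPoch (c * q ^ 2) (q ^ 8) M) =
      qPoch (-(a * q)) (q ^ 8) M * qPoch (-(d * q ^ 7)) (q ^ 8) M := by
  induction M with
  | zero => simp [qPoch_zero]
  | succ M ih =>
    rw [mul_add_one 8, mul_add_one 2, Finset.prod_range_add]
    simp only [qPoch_succ]
    linear_combination (qPoch (q ^ 4) (q ^ 4) (2 * M) * qPoch (c * q ^ 2) (q ^ 8) M) *
      (∏ i ∈ Finset.range (8 * M), partFactor (i + 1)) * prod_partFactor_eight M +
      (1 + a * q * (q ^ 8) ^ M) * (1 + d * q ^ 7 * (q ^ 8) ^ M) * ih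

theorem A4GenFun_mul_qPochInf :
    A4GenFun * (qPochInf (q ^ 4) (q ^ 4) * qPochInf (c * q ^ 2) (q ^ 8)) =
      qPochInf (-(a * q)) (q ^ 8) * qPochInf (-(d * q ^ 7)) (q ^ 8) := by
  have hlim := (tendsto_gapGenFun_zero.mul ((tendsto_qPoch (q ^ 4) (y := q ^ 4) (by simp)).mul
    (tendsto_qPoch (c * q ^ 2) (y := q ^ 8) (by simp)))).sub
    ((tendsto_qPoch (-(a * q)) (y := q ^ 8) (by simp)).mul
      (tendsto_qPoch (-(d * q ^ 7)) (y := q ^ 8) (by simp)))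
  refine sub_eq_zero.1 (tendsto_nhds_unique hlim (tendsto_of_eventually_coeff_eq fun e => ?_))
  filter_upwards [eventually_gt_atTop (e 0)] with s hs
  have hq : q ∈ Ideal.span {q} := Ideal.mem_span_singleton_self q
  have hmem := alSalamChihara_mul_qPoch_sub_mem_pow (Ideal.mul_mem_left _ a hq)
    (Ideal.mul_mem_left _ c (Ideal.pow_mem_of_mem _ hq 2 two_pos)) (d * q ^ 7)
    (Ideal.pow_mem_of_mem _ hq 8 (by norm_num)) (le_refl s) (le_refl s)
  rw [Ideal.span_singleton_pow, Ideal.mem_span_singleton, ← qPoch_mul_gapGenFun_zero,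
    mul_comm (qPoch _ _ s) (gapGenFun s 0), mul_assoc] at hmem
  rw [map_zero]
  exact X_pow_dvd_iff.1 hmem e hs

theorem B4GenFun_mul_qPochInf :
    B4GenFun * (qPochInf (q ^ 4) (q ^ 4) * qPochInf (c * q ^ 2) (q ^ 8)) =
      qPochInf (-(a * q)) (q ^ 8) * qPochInf (-(d * q ^ 7)) (q ^ 8) := by
  have h_eight : Tendsto (fun M : ℕ => 8 * M) atTop atTop :=
    tendsto_id.const_mul_atTop' (by norm_num)
  have h_two : Tendsto (fun M : ℕ => 2 * M) atTop atTop :=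
    tendsto_id.const_mul_atTop' (by norm_num)
  refine tendsto_nhds_unique ((hasProd_partFactor.tendsto_prod_nat.comp h_eight).mul
    (((tendsto_qPoch (q ^ 4) (y := q ^ 4) (by simp)).comp h_two).mul
      (tendsto_qPoch (c * q ^ 2) (y := q ^ 8) (by simp)))) ?_
  exact ((tendsto_qPoch (-(a * q)) (y := q ^ 8) (by simp)).mul
    (tendsto_qPoch (-(d * q ^ 7)) (y := q ^ 8) (by simp))).congr
      fun M => (prod_partFactor_mul_qPoch M).symm

theorem isUnit_qPochInf_mul_qPochInf :
    IsUnit (qPochInf (q ^ 4) (q ^ 4) * qPochInf (c * q ^ 2) (q ^ 8)) := by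
  rw [isUnit_iff_constantCoeff, map_mul, constantCoeff_qPochInf (by simp) (by simp),
    constantCoeff_qPochInf (by simp) (by simp), one_mul]
  exact isUnit_one

theorem A4_eq_B4 (n k l m : ℕ) : A4 n k l m = B4 n k l m := by
  have hgenFun : A4GenFun = B4GenFun :=
    isUnit_qPochInf_mul_qPochInf.mul_right_cancel
      (A4GenFun_mul_qPochInf.trans B4GenFun_mul_qPochInf.symm)
  have hcoeff := congrFun hgenFun (Finsupp.equivFunOnFinite.symm ![n, k, l, m])
  simpa [A4GenFun, B4GenFun] using hcoeff

end ProductSide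

theorem mainTheorem3 :
    -- the formal variables
    let q : MvPowerSeries (Fin 4) ℤ := MvPowerSeries.X 0
    let a : MvPowerSeries (Fin 4) ℤ := MvPowerSeries.X 1
    let c : MvPowerSeries (Fin 4) ℤ := MvPowerSeries.X 2
    let d : MvPowerSeries (Fin 4) ℤ := MvPowerSeries.X 3
    -- the four infinite products converge and the denominator is invertible
    (Multipliable (fun i : ℕ => 1 - (-(a * q)) * (q ^ 8) ^ i) ∧
      Multipliable (fun i : ℕ => 1 - (-(d * q ^ 7)) * (q ^ 8) ^ i) ∧
      Multipliable (fun i : ℕ => 1 - q ^ 4 * (q ^ 4) ^ i) ∧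
      Multipliable (fun i : ℕ => 1 - (c * q ^ 2) * (q ^ 8) ^ i)) ∧
    IsUnit (qPochInf (q ^ 4) (q ^ 4) * qPochInf (c * q ^ 2) (q ^ 8)) ∧
    -- the product formula
    A4GenFun =
      qPochInf (-(a * q)) (q ^ 8) * qPochInf (-(d * q ^ 7)) (q ^ 8) *
        Ring.inverse (qPochInf (q ^ 4) (q ^ 4) * qPochInf (c * q ^ 2) (q ^ 8)) ∧
    -- the partition identity
    ∀ n k l m : ℕ, A4 n k l m = B4 n k l m := by
  intro q a c d
  have hq4 : (q ^ 4).constantCoeff = 0 := by simp [q]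
  have hq8 : (q ^ 8).constantCoeff = 0 := by simp [q]
  refine ⟨⟨multipliable_one_sub_mul_pow _ hq8, multipliable_one_sub_mul_pow _ hq8,
    multipliable_one_sub_mul_pow _ hq4, multipliable_one_sub_mul_pow _ hq8⟩,
    isUnit_qPochInf_mul_qPochInf, ?_, A4_eq_B4⟩
  exact (Ring.eq_mul_inverse_iff_mul_eq _ _ _ isUnit_qPochInf_mul_qPochInf).2 A4GenFun_mul_qPochInf
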